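/- Let $k$ be an infinite field with $\operatorname{char} k \neq 2$, and let $a,b,c,d\in k$ be such that $a$ is not a square in $k$, $b\neq 0$, and at least one of $c,d$ is non-zero. Let $L_0=k(t_1,t_2,t_3,t_4)$ be a field extension of $k$, generated by four elements $t_1,\dots,t_4$, such that $\operatorname{trdeg}_k L_0=2$ and $$t_1^2-a\,t_2^2=b,\qquad t_3^2-a\,t_4^2=2c\,t_1+d .$$ If $k$ is a $C_1$-field, i.e. every homogeneous polynomial $f\in k[x_1,\dots,x_n]$ of degree $m$ with $1\le m<n$ has a non-trivial zero in $k^n$, then $L_0$ is $k$-rational, i.e. $L_0$ is $k$-isomorphic to the field of fractions of a polynomial ring over $k$ in finitely many variables. -/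

import Mathlib

/-- `k` is a `C₁`-field: every homogeneous polynomial over `k` of degree `d ≥ 1` in `n > d`
variables has a non-trivial zero in `kⁿ`. -/
def IsC1Field (k : Type*) [Field k] : Prop :=
  ∀ (n d : ℕ), 0 < d → d < n → ∀ f : MvPolynomial (Fin n) k, f.IsHomogeneous d →
    ∃ x : Fin n → k, x ≠ 0 ∧ MvPolynomial.eval x f = 0

/-- A field extension `L` of `k` is `k`-rational if it is `k`-isomorphic to the field of fractions
of a polynomial ring over `k` in finitely many variables. -/
def IsRationalExtension (k L : Type*) [Field k] [Field L] [Algebra k L] : Prop :=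
  ∃ n : ℕ, Nonempty (L ≃ₐ[k] FractionRing (MvPolynomial (Fin n) k))

/-! Over a `C₁`-field every element is a norm from `k(√a)`. Hence the first conic has a `k`-point
and, unless `t₁, t₂` are constants, a parameter `s`. Multiplying the second equation by `s² - a`,
the norm of `s + √a`, gives a quadric `p² - a q² = A s² + B s + C`. As `A` is a norm, this quadric
has a `k`-point at infinity, and projecting from it leaves two generators. Transcendence degree two
makes them independent. -/

/-- A field of transcendence degree two generated by two elements is rational. -/
theorem isRationalExtension_of_adjoin_pair {k L : Type*} [Field k] [Field L] [Algebra k L]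
    (htrdeg : Algebra.trdeg k L = 2) {u v : L}
    (huv : IntermediateField.adjoin k {u, v} = ⊤) : IsRationalExtension k L := by
  have hrange : Set.range ![u, v] = {u, v} := by
    simp [Matrix.range_cons, Matrix.range_empty, Set.pair_comm]
  have halg : Algebra.IsAlgebraic (Algebra.adjoin k (Set.range ![u, v])) L := by
    refine ⟨fun z => ?_⟩
    have hz : z ∈ IntermediateField.adjoin k (Set.range ![u, v]) := by
      rw [hrange, huv]; trivial
    obtain ⟨r, hr, s, hs, rfl⟩ := IntermediateField.mem_adjoin_iff_div.1 hz
    rw [div_eq_mul_inv]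
    exact (isAlgebraic_algebraMap
        (⟨r, hr⟩ : Algebra.adjoin k (Set.range ![u, v]))).mul
      (isAlgebraic_algebraMap (⟨s, hs⟩ : Algebra.adjoin k (Set.range ![u, v]))).inv
  have hbasis : IsTranscendenceBasis k ![u, v] :=
    Algebra.IsAlgebraic.isTranscendenceBasis_of_lift_le_trdeg_of_finite k _ (by simp [htrdeg])
  have htop : IntermediateField.adjoin k (Set.range ![u, v]) = ⊤ := by rw [hrange, huv]
  exact ⟨2, ⟨((hbasis.1.aevalEquivField.trans (IntermediateField.equivOfEq htop)).trans
    IntermediateField.topEquiv).symm⟩⟩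

/-- Over a `C₁`-field, every element is a norm from a quadratic extension `k(√a)`. -/
theorem IsC1Field.exists_sq_sub_mul_sq_eq {k : Type*} [Field k] (hC1 : IsC1Field k) {a : k}
    (ha : ¬ IsSquare a) (e : k) : ∃ x y : k, x ^ 2 - a * y ^ 2 = e := by
  obtain ⟨w, hw, hzero⟩ := hC1 3 2 (by norm_num) (by norm_num)
    (MvPolynomial.X 0 ^ 2 - MvPolynomial.C a * MvPolynomial.X 1 ^ 2
      - MvPolynomial.C e * MvPolynomial.X 2 ^ 2)
    (((MvPolynomial.isHomogeneous_X_pow _ _).sub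
      ((MvPolynomial.isHomogeneous_X_pow _ _).C_mul _)).sub
      ((MvPolynomial.isHomogeneous_X_pow _ _).C_mul _))
  simp only [map_sub, map_mul, map_pow, MvPolynomial.eval_X, MvPolynomial.eval_C] at hzero
  -- A zero at infinity would make `a` a square.
  have h2 : w 2 ≠ 0 := by
    intro h2
    rw [h2] at hzero
    have h1 : w 1 = 0 := by
      by_contra h1
      refine ha ⟨w 0 / w 1, ?_⟩
      field_simp
      linear_combination -hzero
    have h0 : w 0 = 0 := by
      rw [h1] at hzero
      exact pow_eq_zero_iff (two_ne_zero) |>.1 (by linear_combination hzero)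
    exact hw (funext fun i => by fin_cases i <;> assumption)
  refine ⟨w 0 / w 2, w 1 / w 2, ?_⟩
  field_simp
  linear_combination hzero

/-- Parametrization of the conic `p² - a q² = x² - a y²`, away from two points defined over `k`. -/
theorem exists_conic_parameter {k L : Type*} [Field k] [Field L] [Algebra k L]
    (h2 : (2 : L) ≠ 0) {a x y : k} (ha : a ≠ 0) (hxy : x ^ 2 - a * y ^ 2 ≠ 0) {p q : L}
    (h : p ^ 2 - algebraMap k L a * q ^ 2
      = algebraMap k L x ^ 2 - algebraMap k L a * algebraMap k L y ^ 2) :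
    (∀ F : IntermediateField k L, p ∈ F ∧ q ∈ F) ∨
    ∃ s : L, s ^ 2 - algebraMap k L a ≠ 0 ∧
      p * (s ^ 2 - algebraMap k L a) = algebraMap k L x * (s ^ 2 + algebraMap k L a)
        + 2 * algebraMap k L a * algebraMap k L y * s ∧
      q * (s ^ 2 - algebraMap k L a) = algebraMap k L y * (s ^ 2 + algebraMap k L a)
        + 2 * algebraMap k L x * s := by
  have ha' : algebraMap k L a ≠ 0 := by simpa using ha
  have hn : algebraMap k L x ^ 2 - algebraMap k L a * algebraMap k L y ^ 2 ≠ 0 := by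
    rw [← map_pow, ← map_pow, ← map_mul, ← map_sub]
    exact (map_ne_zero (algebraMap k L)).2 hxy
  have hF (z : k) (F : IntermediateField k L) : algebraMap k L z ∈ F := F.algebraMap_mem z
  generalize algebraMap k L a = A at *
  have hX := hF x
  have hY := hF y
  generalize algebraMap k L x = X at *
  generalize algebraMap k L y = Y at *
  -- `u + v√a = (p + q√a) / (x + y√a)` has norm 1.
  obtain ⟨u, hu⟩ : ∃ u, u * (X ^ 2 - A * Y ^ 2) = X * p - A * Y * q :=
    ⟨_, div_mul_cancel₀ _ hn⟩
  obtain ⟨v, hv⟩ : ∃ v, v * (X ^ 2 - A * Y ^ 2) = X * q - Y * p :=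
    ⟨_, div_mul_cancel₀ _ hn⟩
  have hp : p = X * u + A * Y * v := by
    apply mul_right_cancel₀ hn
    linear_combination -X * hu - A * Y * hv
  have hq : q = X * v + Y * u := by
    apply mul_right_cancel₀ hn
    linear_combination -X * hv - Y * hu
  have huv : u ^ 2 - A * v ^ 2 = 1 := by
    apply mul_right_cancel₀ hn
    rw [hp, hq] at h
    linear_combination h
  by_cases hv0 : v = 0
  · left
    intro F
    have hu' : u ∈ F := by
      have : (u - 1) * (u + 1) = 0 := by rw [hv0] at huv; linear_combination huv
      rcases mul_eq_zero.1 this with h | h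
      · rw [sub_eq_zero.1 h]; exact F.one_mem
      · rw [eq_neg_of_add_eq_zero_left h]; exact F.neg_mem F.one_mem
    rw [hp, hq, hv0]
    simp only [mul_zero, add_zero, zero_add]
    exact ⟨F.mul_mem (hX F) hu', F.mul_mem (hY F) hu'⟩
  · right
    have hu1 : 1 + u ≠ 0 := by
      intro h1
      have hu' : u = -1 := by linear_combination h1
      have : A * v ^ 2 = 0 := by rw [hu'] at huv; linear_combination -huv
      exact (mul_ne_zero ha' (pow_ne_zero 2 hv0)) this
    -- Projection from `(-1, 0)`, as in Hilbert 90: `u + v√a = (s + √a) / (s - √a)`.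
    obtain ⟨s, hs⟩ : ∃ s, s * v = 1 + u := ⟨_, div_mul_cancel₀ _ hv0⟩
    have key : (s ^ 2 - A) * v ^ 2 = 2 * (1 + u) := by
      linear_combination (s * v + 1 + u) * hs + huv
    have hsA : s ^ 2 - A ≠ 0 := by
      intro h0
      rw [h0, zero_mul] at key
      exact mul_ne_zero h2 hu1 key.symm
    have hvs : v * (s ^ 2 - A) = 2 * s := by
      apply mul_right_cancel₀ hv0
      linear_combination key - 2 * hs
    have hus : u * (s ^ 2 - A) = s ^ 2 + A := by
      linear_combination s * hvs - (s ^ 2 - A) * hs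
    refine ⟨s, hsA, ?_, ?_⟩
    · rw [hp]; linear_combination X * hus + A * Y * hvs
    · rw [hq]; linear_combination X * hvs + Y * hus

theorem IntermediateField.mem_of_mul_mem {k L : Type*} [Field k] [Field L] [Algebra k L]
    (F : IntermediateField k L) {x y : L} (hy : y ∈ F) (hy0 : y ≠ 0) (hxy : x * y ∈ F) :
    x ∈ F := by
  rw [← mul_div_cancel_right₀ x hy0]
  exact F.div_mem hxy hy

/-- The function field of a conic with a rational point is generated by one element. -/
theorem exists_conic_generator {k L : Type*} [Field k] [Field L] [Algebra k L]
    (h2 : (2 : L) ≠ 0) {a x y : k} (ha : a ≠ 0) (hxy : x ^ 2 - a * y ^ 2 ≠ 0) {p q : L}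
    (h : p ^ 2 - algebraMap k L a * q ^ 2
      = algebraMap k L x ^ 2 - algebraMap k L a * algebraMap k L y ^ 2) :
    ∃ s : L, ∀ F : IntermediateField k L, s ∈ F → p ∈ F ∧ q ∈ F := by
  rcases exists_conic_parameter h2 ha hxy h with hF | ⟨s, hs0, hp, hq⟩
  · exact ⟨0, fun F _ => hF F⟩
  · refine ⟨s, fun F hs => ?_⟩
    have hz (z : k) : algebraMap k L z ∈ F := F.algebraMap_mem z
    have h2F : (2 : L) ∈ F := ofNat_mem F 2
    have hd : s ^ 2 - algebraMap k L a ∈ F := sub_mem (pow_mem hs 2) (hz a)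
    have hd' : s ^ 2 + algebraMap k L a ∈ F := add_mem (pow_mem hs 2) (hz a)
    constructor
    · refine F.mem_of_mul_mem hd hs0 (hp ▸ add_mem (mul_mem (hz x) hd') ?_)
      exact mul_mem (mul_mem (mul_mem h2F (hz a)) (hz y)) hs
    · refine F.mem_of_mul_mem hd hs0 (hq ▸ add_mem (mul_mem (hz y) hd') ?_)
      exact mul_mem (mul_mem h2F (hz x)) hs

/-- The function field of a quadric surface `p² - a q² = A s² + B s + C` over a `C₁`-field is
generated by two elements. -/
theorem IsC1Field.exists_quadric_generators {k L : Type*} [Field k] [Field L] [Algebra k L]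
    (hC1 : IsC1Field k) (h2 : (2 : k) ≠ 0) {a : k} (ha : ¬ IsSquare a) {A B C : k}
    (hABC : ¬ (A = 0 ∧ B = 0 ∧ C = 0)) {p q s : L}
    (h : p ^ 2 - algebraMap k L a * q ^ 2
      = algebraMap k L A * s ^ 2 + algebraMap k L B * s + algebraMap k L C) :
    ∃ u v : L, ∀ F : IntermediateField k L, u ∈ F → v ∈ F → p ∈ F ∧ q ∈ F ∧ s ∈ F := by
  have ha0 : a ≠ 0 := by rintro rfl; exact ha (IsSquare.zero)
  have h2L : (2 : L) ≠ 0 := by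
    rw [← map_ofNat (algebraMap k L) 2]; simpa using h2
  obtain ⟨x, y, hxy⟩ := hC1.exists_sq_sub_mul_sq_eq ha A
  -- In this case `s` drops out of the equation: the surface is a conic times a line.
  by_cases hdeg : x = 0 ∧ y = 0 ∧ B = 0
  · obtain ⟨rfl, rfl, rfl⟩ := hdeg
    obtain rfl : A = 0 := by rw [← hxy]; ring
    have hC : C ≠ 0 := fun hC => hABC ⟨rfl, rfl, hC⟩
    obtain ⟨x', y', hxy'⟩ := hC1.exists_sq_sub_mul_sq_eq ha C
    obtain ⟨r, hr⟩ := exists_conic_generator h2L ha0 (hxy' ▸ hC) (p := p) (q := q) (by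
      rw [h, ← hxy']; simp)
    exact ⟨r, s, fun F hrF hsF => ⟨(hr F hrF).1, (hr F hrF).2, hsF⟩⟩
  -- With `A = x² - a y²`, this shift cancels the `s²` terms, leaving an equation linear in `s`.
  obtain ⟨u, hu⟩ : ∃ u, p = u + algebraMap k L x * s := ⟨p - algebraMap k L x * s, by ring⟩
  obtain ⟨v, hv⟩ : ∃ v, q = v + algebraMap k L y * s := ⟨q - algebraMap k L y * s, by ring⟩
  have hF (z : k) (F : IntermediateField k L) : algebraMap k L z ∈ F := F.algebraMap_mem z
  have hxyL : algebraMap k L A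
      = algebraMap k L x ^ 2 - algebraMap k L a * algebraMap k L y ^ 2 := by rw [← hxy]; simp
  have key : s * (2 * algebraMap k L x * u - 2 * algebraMap k L a * algebraMap k L y * v
      - algebraMap k L B) = algebraMap k L C - u ^ 2 + algebraMap k L a * v ^ 2 := by
    rw [hu, hv, hxyL] at h
    linear_combination h
  have h2F (F : IntermediateField k L) : (2 : L) ∈ F := ofNat_mem F 2
  have hpqs (F : IntermediateField k L) (huF : u ∈ F) (hvF : v ∈ F) (hsF : s ∈ F) :
      p ∈ F ∧ q ∈ F ∧ s ∈ F :=
    ⟨hu ▸ add_mem huF (mul_mem (hF x F) hsF), hv ▸ add_mem hvF (mul_mem (hF y F) hsF), hsF⟩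
  -- If the coefficient of `s` vanishes, it is a nontrivial linear relation that eliminates `u` or
  -- `v`; otherwise `s` is a rational function of `u` and `v`.
  by_cases hlin : 2 * algebraMap k L x * u - 2 * algebraMap k L a * algebraMap k L y * v
      - algebraMap k L B = 0
  · by_cases hx : x = 0
    · by_cases hy : y = 0
      · refine absurd ⟨hx, hy, ?_⟩ hdeg
        simpa [hx, hy] using hlin
      · refine ⟨u, s, fun F huF hsF => hpqs F huF ?_ hsF⟩
        refine F.mem_of_mul_mem (y := 2 * algebraMap k L a * algebraMap k L y)
          (mul_mem (mul_mem (h2F F) (hF a F)) (hF y F)) (by simp [h2L, ha0, hy]) ?_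
        have : v * (2 * algebraMap k L a * algebraMap k L y)
            = 2 * algebraMap k L x * u - algebraMap k L B := by linear_combination -hlin
        rw [this]
        exact sub_mem (mul_mem (mul_mem (h2F F) (hF x F)) huF) (hF B F)
    · refine ⟨v, s, fun F hvF hsF => hpqs F ?_ hvF hsF⟩
      refine F.mem_of_mul_mem (y := 2 * algebraMap k L x)
        (mul_mem (h2F F) (hF x F)) (by simp [h2L, hx]) ?_
      have : u * (2 * algebraMap k L x)
          = 2 * algebraMap k L a * algebraMap k L y * v + algebraMap k L B := by
        linear_combination hlin
      rw [this]
      exact add_mem (mul_mem (mul_mem (mul_mem (h2F F) (hF a F)) (hF y F)) hvF) (hF B F)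
  · refine ⟨u, v, fun F huF hvF => hpqs F huF hvF (F.mem_of_mul_mem ?_ hlin (key ▸ ?_))⟩
    · exact sub_mem (sub_mem (mul_mem (mul_mem (h2F F) (hF x F)) huF)
        (mul_mem (mul_mem (mul_mem (h2F F) (hF a F)) (hF y F)) hvF)) (hF B F)
    · exact add_mem (sub_mem (hF C F) (pow_mem huF 2)) (mul_mem (hF a F) (pow_mem hvF 2))

theorem lemma1p6 {k : Type*} [Field k] [Infinite k] (hchar : ringChar k ≠ 2)
    (hC1 : IsC1Field k)
    (a b c d : k) (ha : ¬ IsSquare a) (hb : b ≠ 0) (hcd : c ≠ 0 ∨ d ≠ 0)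
    {L₀ : Type*} [Field L₀] [Algebra k L₀] (t₁ t₂ t₃ t₄ : L₀)
    (hgen : IntermediateField.adjoin k {t₁, t₂, t₃, t₄} = ⊤)
    (htrdeg : Algebra.trdeg k L₀ = 2)
    (h₁ : t₁ ^ 2 - algebraMap k L₀ a * t₂ ^ 2 = algebraMap k L₀ b)
    (h₂ : t₃ ^ 2 - algebraMap k L₀ a * t₄ ^ 2
      = 2 * algebraMap k L₀ c * t₁ + algebraMap k L₀ d) :
    IsRationalExtension k L₀ := by
  have h2 : (2 : k) ≠ 0 := Ring.two_ne_zero hchar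
  have h2L : (2 : L₀) ≠ 0 := by
    rw [← map_ofNat (algebraMap k L₀) 2]; simpa using h2
  have ha0 : a ≠ 0 := by rintro rfl; exact ha (IsSquare.zero)
  suffices ∃ u v : L₀, ∀ F : IntermediateField k L₀, u ∈ F → v ∈ F →
      t₁ ∈ F ∧ t₂ ∈ F ∧ t₃ ∈ F ∧ t₄ ∈ F by
    obtain ⟨u, v, huv⟩ := this
    refine isRationalExtension_of_adjoin_pair htrdeg (u := u) (v := v) (top_le_iff.1 ?_)
    obtain ⟨m₁, m₂, m₃, m₄⟩ := huv (IntermediateField.adjoin k {u, v})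
      (IntermediateField.subset_adjoin _ _ (by simp))
      (IntermediateField.subset_adjoin _ _ (by simp))
    rw [← hgen, IntermediateField.adjoin_le_iff]
    rintro z (rfl | rfl | rfl | rfl) <;> assumption
  obtain ⟨x, y, rfl⟩ := hC1.exists_sq_sub_mul_sq_eq ha b
  rcases exists_conic_parameter h2L ha0 hb (p := t₁) (q := t₂) (by rw [h₁]; simp) with
    hF | ⟨s, hs0, ht₁, ht₂⟩
  · exact ⟨t₃, t₄, fun F h3 h4 => ⟨(hF F).1, (hF F).2, h3, h4⟩⟩
  -- These are the coefficients of `(s² - a)(2c t₁ + d)` as a quadratic in `s`.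
  have hcoeff : ¬ (2 * c * x + d = 0 ∧ 4 * a * c * y = 0 ∧ a * (2 * c * x - d) = 0) := by
    rintro ⟨hA, hB, hC⟩
    have hC' : 2 * c * x - d = 0 := (mul_eq_zero.1 hC).resolve_left ha0
    have hd : d = 0 := by
      apply mul_left_cancel₀ h2
      linear_combination hA - hC'
    have hc : c ≠ 0 := hcd.resolve_right (not_not.2 hd)
    have hx : x = 0 := by
      apply mul_left_cancel₀ (mul_ne_zero h2 hc)
      linear_combination hA - hd
    have hy : y = 0 := by
      apply mul_left_cancel₀ (mul_ne_zero (mul_ne_zero (mul_ne_zero h2 h2) ha0) hc)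
      linear_combination hB
    exact hb (by rw [hx, hy]; ring)
  obtain ⟨u, v, huv⟩ := hC1.exists_quadric_generators h2 ha hcoeff
    -- `p + q√a = (s + √a)(t₃ + t₄√a)`, so norms multiply.
    (p := s * t₃ + algebraMap k L₀ a * t₄) (q := t₃ + s * t₄) (s := s) (by
      simp only [map_add, map_sub, map_mul, map_ofNat]
      linear_combination (s ^ 2 - algebraMap k L₀ a) * h₂ + 2 * algebraMap k L₀ c * ht₁)
  refine ⟨u, v, fun F hu hv => ?_⟩
  obtain ⟨hp, hq, hs⟩ := huv F hu hv
  have hz (z : k) : algebraMap k L₀ z ∈ F := F.algebraMap_mem z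
  have h2F : (2 : L₀) ∈ F := ofNat_mem F 2
  have hd : s ^ 2 - algebraMap k L₀ a ∈ F := sub_mem (pow_mem hs 2) (hz a)
  have hd' : s ^ 2 + algebraMap k L₀ a ∈ F := add_mem (pow_mem hs 2) (hz a)
  refine ⟨F.mem_of_mul_mem hd hs0 ?_, F.mem_of_mul_mem hd hs0 ?_,
    F.mem_of_mul_mem hd hs0 ?_, F.mem_of_mul_mem hd hs0 ?_⟩
  · rw [ht₁]
    exact add_mem (mul_mem (hz x) hd') (mul_mem (mul_mem (mul_mem h2F (hz a)) (hz y)) hs)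
  · rw [ht₂]
    exact add_mem (mul_mem (hz y) hd') (mul_mem (mul_mem h2F (hz x)) hs)
  -- Multiplying `p + q√a` by `s - √a` recovers `t₃` and `t₄` up to the factor `s² - a`.
  · have : t₃ * (s ^ 2 - algebraMap k L₀ a)
        = s * (s * t₃ + algebraMap k L₀ a * t₄) - algebraMap k L₀ a * (t₃ + s * t₄) := by ring
    rw [this]
    exact sub_mem (mul_mem hs hp) (mul_mem (hz a) hq)
  · have : t₄ * (s ^ 2 - algebraMap k L₀ a)
        = s * (t₃ + s * t₄) - (s * t₃ + algebraMap k L₀ a * t₄) := by ring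
    rw [this]
    exact sub_mem (mul_mem hs hq) hp
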